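/- \textbf{Gödel's Completeness Theorem (via the Rasiowa--Sikorski term model).} Let $L$ be a first-order language with equality $==$, variables $x_0,x_1,\dots$, and countably many constants, function symbols and predicate symbols. Formulas are built from atomic formulas by $\wedge,\neg,\forall x$; put $\varphi\vee\psi:=\neg(\neg\varphi\wedge\neg\psi)$, $\varphi\to\psi:=\neg\varphi\vee\psi$, $\varphi\leftrightarrow\psi:=(\varphi\to\psi)\wedge(\psi\to\varphi)$, $\exists x.\varphi:=\neg\forall x.\neg\varphi$. Deducibility $T\vdash\varphi$ is given by the axioms: all propositional tautologies; $x==x$; $y_1==z_1\to\dots\to y_n==z_n\to f(y_1,\dots,y_n)==f(z_1,\dots,z_n)$ for function symbols $f$, and $y_1==z_1\to\dots\to y_n==z_n\to p(y_1,\dots,y_n)\to p(z_1,\dots,z_n)$ for predicate symbols $p$ including $==$ (with variables $y_i,z_i$); $\varphi_x[t]\to\exists x.\varphi$ and $\forall x.\varphi\to\varphi_x[t]$ for every term $t$ that is free for $x$ in $\varphi$; and the rules: modus ponens; from $\varphi$ infer $\forall x.\varphi$; from $\psi\to\varphi$ infer $\psi\to\forall x.\varphi$ if $x$ is not free in $\psi$.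 $T$ is consistent iff not every formula is deducible from $T$. Let $T$ be a consistent set of sentences. Let $\mathbf{B}_T$ be its Lindenbaum algebra, i.e. the Boolean algebra of the classes $[\varphi]$ of formulas modulo $T\vdash\varphi\leftrightarrow\psi$, with operations induced by $\wedge,\vee,\neg$. For $k,p\in\mathbb{N}$ let $\varphi(k/p)$ arise from $\varphi$ by replacing all bound occurrences of $x_p$ by the first variable not occurring in $\varphi$ and then all free occurrences of $x_k$ by $x_p$. Then $T$ has a model; more precisely: (a) $\sup_{p\in\mathbb{N}}[\varphi(k/p)]=[\exists x_k.\varphi]$ in $\mathbf{B}_T$ for all $\varphi$ and $k$. (b) There is an ultrafilter $F$ on $\mathbf{B}_T$ that preserves all these suprema, i.e. such that for all $\varphi$ and $k$, $\sup_p[\varphi(k/p)]\in F$ iff $[\varphi(k/p)]\in F$ for some $p$. (c) For every ultrafilter $F$ as in (b), let $A=\{\hat x_n\mid n\in\mathbb{N}\}$ be the set of classes of variables modulo $x_i\approx x_j:\Leftrightarrow[x_i==x_j]\in F$, and interpret the variable $x_n$ by $\hat x_n$. There is exactly one interpretation of the symbols of $L$ on $A$ such that, writing $t_A$ for the value of the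 term $t$: $f_A(t_{1,A},\dots,t_{n,A})=\hat x_j$ whenever $[f(t_1,\dots,t_n)==x_j]\in F$ (for constants: $c_A=\hat x_j$ whenever $[c==x_j]\in F$), and $\langle t_{1,A},\dots,t_{n,A}\rangle\in p_A$ iff $[p(t_1,\dots,t_n)]\in F$, for all symbols $f$, $p$, terms $t_i$ and $j\in\mathbb{N}$. With this interpretation $\mathcal{A}$, $\mathcal{A}\models\varphi$ iff $[\varphi]\in F$ for every formula $\varphi$, and $\mathcal{A}\models\varphi$ for every $\varphi\in T$. -/

import Mathlib

universe u v

namespace FOL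

open FirstOrder FirstOrder.Language

/-- First-order formulas with equality over the symbols of `L`, with named variables `x₀, x₁, …`
(terms are Mathlib's `L.Term ℕ`; constants are the nullary function symbols).
The primitive connectives are `∧`, `¬` and `∀ xᵢ`. -/
inductive Fml (L : FirstOrder.Language.{u, v}) : Type (max u v)
  | eq (t s : L.Term ℕ) : Fml L
  | rel {n : ℕ} (R : L.Relations n) (ts : Fin n → L.Term ℕ) : Fml L
  | and (φ ψ : Fml L) : Fml L
  | not (φ : Fml L) : Fml L
  | all (x : ℕ) (φ : Fml L) : Fml L

namespace Fml

variable {L : FirstOrder.Language.{u, v}}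

/-- `φ ∨ ψ` abbreviates `¬(¬φ ∧ ¬ψ)`. -/
def or (φ ψ : Fml L) : Fml L := not (and (not φ) (not ψ))

/-- `φ → ψ` abbreviates `¬φ ∨ ψ`. -/
def imp (φ ψ : Fml L) : Fml L := or (not φ) ψ

/-- `φ ↔ ψ` abbreviates `(φ → ψ) ∧ (ψ → φ)`. -/
def iff (φ ψ : Fml L) : Fml L := and (imp φ ψ) (imp ψ φ)

/-- `∃ x. φ` abbreviates `¬ ∀ x. ¬φ`. -/
def ex (x : ℕ) (φ : Fml L) : Fml L := not (all x (not φ))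

/-- The atomic formula `xᵢ == xⱼ`. -/
def varEq (i j : ℕ) : Fml L := eq (Term.var i) (Term.var j)

/-- All variables occurring in a formula, whether free, bound, or next to a quantifier. -/
def vars : Fml L → Finset ℕ
  | eq t s => t.varFinset ∪ s.varFinset
  | rel _ ts => Finset.univ.biUnion fun i => (ts i).varFinset
  | and φ ψ => φ.vars ∪ ψ.vars
  | not φ => φ.vars
  | all x φ => insert x φ.vars

/-- The variables that occur free in a formula. -/
def freeVars : Fml L → Finset ℕ
  | eq t s => t.varFinset ∪ s.varFinset
  | rel _ ts => Finset.univ.biUnion fun i => (ts i).varFinset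
  | and φ ψ => φ.freeVars ∪ ψ.freeVars
  | not φ => φ.freeVars
  | all x φ => φ.freeVars.erase x

/-- A sentence is a formula without free variables. -/
def IsSentence (φ : Fml L) : Prop := φ.freeVars = ∅

/-- Replacement of the variable `x` by the term `t` in a term. -/
def substTerm (x : ℕ) (t : L.Term ℕ) (s : L.Term ℕ) : L.Term ℕ :=
  s.subst (Function.update Term.var x t)

/-- `φ_x[t]`: all free occurrences of `x` in `φ` are replaced by `t`. -/
def subst (x : ℕ) (t : L.Term ℕ) : Fml L → Fml L
  | eq s₁ s₂ => eq (substTerm x t s₁) (substTerm x t s₂)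
  | rel R ts => rel R fun i => substTerm x t (ts i)
  | and φ ψ => and (subst x t φ) (subst x t ψ)
  | not φ => not (subst x t φ)
  | all y φ => if y = x then all y φ else all y (subst x t φ)

/-- `t` is free for `x` in `φ`: no free occurrence of `x` in `φ` lies in the scope of a quantifier
over a variable of `t`. -/
def FreeFor (x : ℕ) (t : L.Term ℕ) : Fml L → Prop
  | eq _ _ => True
  | rel _ _ => True
  | and φ ψ => FreeFor x t φ ∧ FreeFor x t ψ
  | not φ => FreeFor x t φ
  | all y φ => x ∉ (all y φ).freeVars ∨ (y ∉ t.varFinset ∧ FreeFor x t φ)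

/-- All bound occurrences of `x_p` (including those next to a quantifier) are replaced by `x_l`. -/
def renameBound (p l : ℕ) : Fml L → Fml L
  | eq t s => eq t s
  | rel R ts => rel R ts
  | and φ ψ => and (renameBound p l φ) (renameBound p l ψ)
  | not φ => not (renameBound p l φ)
  | all x φ =>
      if x = p then all l (subst p (Term.var l) (renameBound p l φ))
      else all x (renameBound p l φ)

/-- The first index of a variable that does not occur in `φ`. -/
noncomputable def freshVar (φ : Fml L) : ℕ := sInf {l : ℕ | l ∉ φ.vars}

/-- The formula `φ(k/p)`: all bound occurrences of `x_p` are replaced by the first variable that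
does not occur in `φ`, then all free occurrences of `x_k` are replaced by `x_p`. -/
noncomputable def inst (φ : Fml L) (k p : ℕ) : Fml L :=
  subst k (Term.var p) (renameBound p φ.freshVar φ)

/-- Propositional evaluation, where the atomic formulas and the formulas `∀ x. φ` count as
propositional letters, with truth values given by `e`. -/
def PropEval (e : Fml L → Prop) : Fml L → Prop
  | eq t s => e (eq t s)
  | rel R ts => e (rel R ts)
  | and φ ψ => PropEval e φ ∧ PropEval e ψ
  | not φ => ¬ PropEval e φ
  | all x φ => e (all x φ)

/-- Propositional tautologies. -/
def IsTautology (φ : Fml L) : Prop := ∀ e : Fml L → Prop, φ.PropEval e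

/-- `y₁ == z₁ → (y₂ == z₂ → (… → (yₙ == zₙ → φ)))` for variables `yᵢ`, `zᵢ`. -/
def eqChain {n : ℕ} (y z : Fin n → ℕ) (φ : Fml L) : Fml L :=
  (List.ofFn fun i => (varEq (y i) (z i) : Fml L)).foldr imp φ

end Fml

/-- `Provable T φ` is `T ⊢ φ`: the Hilbert calculus of first-order logic with identity. -/
inductive Provable {L : FirstOrder.Language.{u, v}} (T : Set (Fml L)) : Fml L → Prop
  | hyp {φ : Fml L} : φ ∈ T → Provable T φ
  | taut {φ : Fml L} : φ.IsTautology → Provable T φ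
  | identity (x : ℕ) : Provable T (Fml.varEq x x)
  | eqFun {n : ℕ} (f : L.Functions n) (y z : Fin n → ℕ) :
      Provable T (Fml.eqChain y z
        (Fml.eq (Term.func f fun i => Term.var (y i)) (Term.func f fun i => Term.var (z i))))
  | eqRel {n : ℕ} (R : L.Relations n) (y z : Fin n → ℕ) :
      Provable T (Fml.eqChain y z
        (Fml.imp (Fml.rel R fun i => Term.var (y i)) (Fml.rel R fun i => Term.var (z i))))
  /-- The equality axiom for the binary predicate `==` itself. -/
  | eqEq (y₁ y₂ z₁ z₂ : ℕ) :
      Provable T (Fml.imp (Fml.varEq y₁ z₁) (Fml.imp (Fml.varEq y₂ z₂)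
        (Fml.imp (Fml.varEq y₁ y₂) (Fml.varEq z₁ z₂))))
  /-- Substitution axiom `φ_x[t] → ∃ x. φ`. -/
  | exIntro (φ : Fml L) (x : ℕ) (t : L.Term ℕ) : φ.FreeFor x t →
      Provable T (Fml.imp (φ.subst x t) (Fml.ex x φ))
  /-- Substitution axiom `∀ x. φ → φ_x[t]`. -/
  | allElim (φ : Fml L) (x : ℕ) (t : L.Term ℕ) : φ.FreeFor x t →
      Provable T (Fml.imp (Fml.all x φ) (φ.subst x t))
  | modusPonens {φ ψ : Fml L} : Provable T φ → Provable T (Fml.imp φ ψ) → Provable T ψ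
  | generalization {φ : Fml L} (x : ℕ) : Provable T φ → Provable T (Fml.all x φ)
  /-- From `ψ → φ` infer `ψ → ∀ x. φ`, if `x` is not free in `ψ`. -/
  | allIntro {φ ψ : Fml L} (x : ℕ) : x ∉ ψ.freeVars →
      Provable T (Fml.imp ψ φ) → Provable T (Fml.imp ψ (Fml.all x φ))

/-- `T` is consistent: not every formula is deducible from `T`. -/
def Consistent {L : FirstOrder.Language.{u, v}} (T : Set (Fml L)) : Prop := ¬ ∀ φ : Fml L, Provable T φ

section Semantics

variable {L : FirstOrder.Language.{u, v}} {A : Type*} [L.Structure A]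

/-- `(A, w) ⊨ φ`, where the variable `x_i` is interpreted by `w i`. -/
def Holds : (ℕ → A) → Fml L → Prop
  | w, .eq t s => t.realize w = s.realize w
  | w, .rel R ts => Structure.RelMap R fun i => (ts i).realize w
  | w, .and φ ψ => Holds w φ ∧ Holds w ψ
  | w, .not φ => ¬ Holds w φ
  | w, .all x φ => ∀ a : A, Holds (Function.update w x a) φ

end Semantics

/-- `T` has a model `(A, w)`. -/
def HasModel {L : FirstOrder.Language.{u, v}} (T : Set (Fml L)) : Prop :=
  ∃ (A : Type) (_ : L.Structure A) (w : ℕ → A), ∀ φ ∈ T, Holds w φ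

section LindenbaumAlgebra

variable {L : FirstOrder.Language.{u, v}} {T : Set (Fml L)}

theorem Provable.taut₁ {φ ψ : Fml L} (h : Provable T φ) (ht : (φ.imp ψ).IsTautology) :
    Provable T ψ :=
  .modusPonens h (.taut ht)

theorem Provable.taut₂ {φ ψ χ : Fml L} (h₁ : Provable T φ) (h₂ : Provable T ψ)
    (ht : (φ.imp (ψ.imp χ)).IsTautology) : Provable T χ :=
  .modusPonens h₂ (.modusPonens h₁ (.taut ht))

theorem provable_iff_iff {φ ψ : Fml L} :
    Provable T (φ.iff ψ) ↔ Provable T (φ.imp ψ) ∧ Provable T (ψ.imp φ) := by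
  refine ⟨fun h => ⟨h.taut₁ ?_, h.taut₁ ?_⟩, fun h => h.1.taut₂ h.2 ?_⟩ <;> intro e <;>
    simp only [Fml.iff, Fml.imp, Fml.or, Fml.PropEval] <;> tauto

theorem Provable.imp_refl (φ : Fml L) : Provable T (φ.imp φ) :=
  .taut fun e => by simp only [Fml.imp, Fml.or, Fml.PropEval]; tauto

theorem Provable.imp_trans {φ ψ χ : Fml L} (h₁ : Provable T (φ.imp ψ))
    (h₂ : Provable T (ψ.imp χ)) : Provable T (φ.imp χ) :=
  h₁.taut₂ h₂ fun e => by simp only [Fml.imp, Fml.or, Fml.PropEval]; tauto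

variable (T) in
/-- `φ ∼ ψ` iff `T ⊢ φ ↔ ψ`. -/
def lindenbaumSetoid : Setoid (Fml L) where
  r φ ψ := Provable T (φ.iff ψ)
  iseqv :=
    { refl := fun φ => provable_iff_iff.2 ⟨.imp_refl φ, .imp_refl φ⟩
      symm := fun h => provable_iff_iff.2 (provable_iff_iff.1 h).symm
      trans := fun h₁ h₂ => provable_iff_iff.2
        ⟨(provable_iff_iff.1 h₁).1.imp_trans (provable_iff_iff.1 h₂).1,
          (provable_iff_iff.1 h₂).2.imp_trans (provable_iff_iff.1 h₁).2⟩ }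

variable (T) in
/-- The Lindenbaum algebra of `T`. -/
def Lindenbaum : Type (max u v) := Quotient (lindenbaumSetoid T)

variable (T) in
/-- The class `[φ]` in the Lindenbaum algebra of `T`. -/
def cls (φ : Fml L) : Lindenbaum T := Quotient.mk (lindenbaumSetoid T) φ

/-- The Boolean algebra structure: `[φ] ≤ [ψ]` iff `T ⊢ φ → ψ`, and `∧`, `∨`, `¬` act on
representatives. -/
instance : BooleanAlgebra (Lindenbaum T) where
  le := Quotient.lift₂ (fun φ ψ => Provable T (φ.imp ψ)) (by
    intro a b c d h₁ h₂
    obtain ⟨h₁, h₁'⟩ := provable_iff_iff.1 h₁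
    obtain ⟨h₂, h₂'⟩ := provable_iff_iff.1 h₂
    exact propext ⟨fun h => (h₁'.imp_trans h).imp_trans h₂, fun h => (h₁.imp_trans h).imp_trans h₂'⟩)
  inf := Quotient.lift₂ (fun φ ψ => cls T (φ.and ψ)) (by
    intro a b c d h₁ h₂
    refine Quotient.sound (Provable.taut₂ h₁ h₂ fun e => ?_)
    simp only [Fml.iff, Fml.imp, Fml.or, Fml.PropEval]; tauto)
  sup := Quotient.lift₂ (fun φ ψ => cls T (φ.or ψ)) (by
    intro a b c d h₁ h₂
    refine Quotient.sound (Provable.taut₂ h₁ h₂ fun e => ?_)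
    simp only [Fml.iff, Fml.imp, Fml.or, Fml.PropEval]; tauto)
  compl := Quotient.lift (fun φ => cls T φ.not) (by
    intro a b h
    refine Quotient.sound (Provable.taut₁ h fun e => ?_)
    simp only [Fml.iff, Fml.imp, Fml.or, Fml.PropEval]; tauto)
  top := cls T ((Fml.varEq 0 0).imp (Fml.varEq 0 0))
  bot := cls T ((Fml.varEq 0 0).imp (Fml.varEq 0 0)).not
  le_refl := by rintro ⟨φ⟩; exact Provable.imp_refl φ
  le_trans := by rintro ⟨φ⟩ ⟨ψ⟩ ⟨χ⟩ h₁ h₂; exact Provable.imp_trans h₁ h₂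
  le_antisymm := by rintro ⟨φ⟩ ⟨ψ⟩ h₁ h₂; exact Quotient.sound (provable_iff_iff.2 ⟨h₁, h₂⟩)
  inf_le_left := by
    rintro ⟨φ⟩ ⟨ψ⟩
    exact Provable.taut fun e => by simp only [Fml.imp, Fml.or, Fml.PropEval]; tauto
  inf_le_right := by
    rintro ⟨φ⟩ ⟨ψ⟩
    exact Provable.taut fun e => by simp only [Fml.imp, Fml.or, Fml.PropEval]; tauto
  le_inf := by
    rintro ⟨φ⟩ ⟨ψ⟩ ⟨χ⟩ h₁ h₂
    exact Provable.taut₂ h₁ h₂ fun e => by simp only [Fml.imp, Fml.or, Fml.PropEval]; tauto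
  le_sup_left := by
    rintro ⟨φ⟩ ⟨ψ⟩
    exact Provable.taut fun e => by simp only [Fml.imp, Fml.or, Fml.PropEval]; tauto
  le_sup_right := by
    rintro ⟨φ⟩ ⟨ψ⟩
    exact Provable.taut fun e => by simp only [Fml.imp, Fml.or, Fml.PropEval]; tauto
  sup_le := by
    rintro ⟨φ⟩ ⟨ψ⟩ ⟨χ⟩ h₁ h₂
    exact Provable.taut₂ h₁ h₂ fun e => by simp only [Fml.imp, Fml.or, Fml.PropEval]; tauto
  le_sup_inf := by
    rintro ⟨φ⟩ ⟨ψ⟩ ⟨χ⟩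
    exact Provable.taut fun e => by simp only [Fml.imp, Fml.or, Fml.PropEval]; tauto
  inf_compl_le_bot := by
    rintro ⟨φ⟩
    exact Provable.taut fun e => by simp only [Fml.imp, Fml.or, Fml.PropEval]; tauto
  top_le_sup_compl := by
    rintro ⟨φ⟩
    exact Provable.taut fun e => by simp only [Fml.imp, Fml.or, Fml.PropEval]; tauto
  le_top := by
    rintro ⟨φ⟩
    exact Provable.taut fun e => by simp only [Fml.imp, Fml.or, Fml.PropEval]; tauto
  bot_le := by
    rintro ⟨φ⟩
    exact Provable.taut fun e => by simp only [Fml.imp, Fml.or, Fml.PropEval]; tauto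

theorem cls_le_cls {φ ψ : Fml L} : cls T φ ≤ cls T ψ ↔ Provable T (φ.imp ψ) := Iff.rfl

theorem cls_inf_cls (φ ψ : Fml L) : cls T φ ⊓ cls T ψ = cls T (φ.and ψ) := rfl

theorem cls_sup_cls (φ ψ : Fml L) : cls T φ ⊔ cls T ψ = cls T (φ.or ψ) := rfl

theorem compl_cls (φ : Fml L) : (cls T φ)ᶜ = cls T φ.not := rfl

theorem cls_eq_top {φ : Fml L} : cls T φ = ⊤ ↔ Provable T φ := by
  rw [← top_le_iff]
  refine ⟨fun h => Provable.modusPonens (Provable.imp_refl _) (cls_le_cls.1 h), fun h => ?_⟩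
  exact cls_le_cls.2 (h.taut₁ fun e => by simp only [Fml.imp, Fml.or, Fml.PropEval]; tauto)

theorem cls_eq_bot {φ : Fml L} : cls T φ = ⊥ ↔ Provable T φ.not := by
  rw [← cls_eq_top, ← compl_cls, compl_eq_top]

end LindenbaumAlgebra

/-- An ultrafilter of a Boolean algebra: a maximal proper filter. -/
def IsUltra {B : Type*} [BooleanAlgebra B] (F : Order.PFilter B) : Prop :=
  Maximal (fun G : Order.PFilter B => ⊥ ∉ G) F

/-- `F` preserves the supremum of `S` (which has to exist): `sup S ∈ F` iff `s ∈ F` for some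
`s ∈ S`. -/
def PreservesSup {B : Type*} [BooleanAlgebra B] (F : Order.PFilter B) (S : Set B) : Prop :=
  ∃ b : B, IsLUB S b ∧ (b ∈ F ↔ ∃ s ∈ S, s ∈ F)

section TermModel

variable {L : FirstOrder.Language.{u, v}} {T : Set (Fml L)}

variable (T) in
/-- The family `{[φ(k/p)] ∣ p ∈ ℕ}` in the Lindenbaum algebra. -/
def instances (φ : Fml L) (k : ℕ) : Set (Lindenbaum T) :=
  Set.range fun p : ℕ => cls T (φ.inst k p)

/-- `F` preserves all suprema that arise from existentially quantified formulas. -/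
def PreservesQuantifiers (F : Order.PFilter (Lindenbaum T)) : Prop :=
  ∀ (φ : Fml L) (k : ℕ), PreservesSup F (instances T φ k)

/-- `xᵢ ≈ xⱼ` iff `[xᵢ == xⱼ] ∈ F`. -/
def varSetoid (F : Order.PFilter (Lindenbaum T)) : Setoid ℕ where
  r i j := cls T (Fml.varEq i j) ∈ F
  iseqv :=
    { refl := fun i => by
        rw [cls_eq_top.2 (Provable.identity i)]
        exact Order.PFilter.top_mem
      symm := fun {i j} h => Order.PFilter.mem_of_le (cls_le_cls.2 ((Provable.identity i).taut₂
        (Provable.eqEq i i j i) fun e => by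
          simp only [Fml.imp, Fml.or, Fml.varEq, Fml.PropEval]; tauto)) h
      trans := fun {i j k} h₁ h₂ => Order.PFilter.mem_of_le (cls_le_cls.2
        ((Provable.identity i).taut₂ (Provable.eqEq i j i k) fun e => by
          simp only [Fml.imp, Fml.or, Fml.varEq, Fml.PropEval]; tauto))
        (Order.PFilter.inf_mem h₁ h₂) }

/-- The carrier `{x̂ₙ ∣ n ∈ ℕ}` of the term model. -/
def Carrier (F : Order.PFilter (Lindenbaum T)) : Type := Quotient (varSetoid F)

/-- The class `x̂ₙ` of the variable `xₙ`; it also interprets the variable `xₙ`. -/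
def hat (F : Order.PFilter (Lindenbaum T)) (n : ℕ) : Carrier F := Quotient.mk (varSetoid F) n

/-- `S` is the interpretation of the symbols of `L` in the term model of `F`:
if `[f(t₁, …, tₙ) == xⱼ] ∈ F` then `f_A(t_{A,1}, …, t_{A,n}) = x̂ⱼ` (for `n = 0` this is the clause
for constants), and `⟨t_{A,1}, …, t_{A,n}⟩ ∈ p_A` iff `[p(t₁, …, tₙ)] ∈ F`. -/
structure IsTermModel (F : Order.PFilter (Lindenbaum T)) (S : L.Structure (Carrier F)) :
    Prop where
  funMap_eq : ∀ {n : ℕ} (f : L.Functions n) (ts : Fin n → L.Term ℕ) (j : ℕ),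
    cls T (Fml.eq (Term.func f ts) (Term.var j)) ∈ F →
      Structure.funMap f (fun i => (ts i).realize (hat F)) = hat F j
  relMap_iff : ∀ {n : ℕ} (R : L.Relations n) (ts : Fin n → L.Term ℕ),
    Structure.RelMap R (fun i => (ts i).realize (hat F)) ↔ cls T (Fml.rel R ts) ∈ F

end TermModel

end FOL

namespace FOL

open FirstOrder FirstOrder.Language

/-! ### Substitution in terms -/

section Terms

variable {L : FirstOrder.Language.{u, v}}

/-! The model is built from variables alone, and an ultrafilter on the Lindenbaum algebra serves as
its truth definition.

The quantifier rules make `[∃x_k.φ]` the least upper bound of the `[φ(k/p)]` (`isLUB_instances`): an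
upper bound `[ψ]` dominates in particular an instance whose `p` occurs in neither `φ` nor `ψ`, and
`p` can then be quantified away. There are only countably many pairs `(φ, k)`, so the
Rasiowa–Sikorski lemma (`exists_isUltra_preservesSup`) gives an ultrafilter `F` preserving all these
suprema. It works as a Henkin theory whose witnesses are variables.

Since `∃x_k. t == x_k` is provable for `k` not in `t`, every term is `F`-equal to a variable
(`exists_eq_var`). Hence classes of variables suffice as carrier, and the equality axioms make the
operations and relations on them well defined. Those axioms speak of variables only;
`Provable.qfSubst` transfers them to arbitrary terms.

Truth in the model then agrees with membership in `F` (`IsTermModel.holds_iff`): `∧` and `¬` use the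
ultrafilter properties, and `∀` uses preservation of suprema, since every element of the carrier is
named by a variable. Members of `T` have class `⊤`, so they hold. -/

theorem term_subst_congr {σ τ : ℕ → L.Term ℕ} (t : L.Term ℕ)
    (h : ∀ v ∈ t.varFinset, σ v = τ v) : t.subst σ = t.subst τ := by
  induction t with
  | var i => exact h i (by simp [Term.varFinset])
  | func f ts ih =>
    simp only [Term.subst, Term.func.injEq, heq_eq_eq, true_and]
    funext i
    exact ih i fun v hv => h v (by
      simp only [Term.varFinset, Finset.mem_biUnion, Finset.mem_univ, true_and]; exact ⟨i, hv⟩)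

theorem term_subst_var (t : L.Term ℕ) : t.subst Term.var = t := by
  induction t with
  | var i => rfl
  | func f ts ih => simp [Term.subst, ih]

theorem term_subst_subst (σ τ : ℕ → L.Term ℕ) (t : L.Term ℕ) :
    (t.subst σ).subst τ = t.subst fun v => (σ v).subst τ := by
  induction t with
  | var i => rfl
  | func f ts ih => simp [Term.subst, ih]

theorem mem_varFinset_subst {σ : ℕ → L.Term ℕ} {t : L.Term ℕ} {a : ℕ} :
    a ∈ (t.subst σ).varFinset ↔ ∃ v ∈ t.varFinset, a ∈ (σ v).varFinset := by
  induction t with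
  | var i => simp [Term.subst, Term.varFinset]
  | func f ts ih =>
    simp only [Term.subst, Term.varFinset, Finset.mem_biUnion, Finset.mem_univ, true_and, ih]
    tauto

theorem substTerm_of_notMem {x : ℕ} {t s : L.Term ℕ} (h : x ∉ s.varFinset) :
    Fml.substTerm x t s = s := by
  rw [Fml.substTerm, term_subst_congr (τ := Term.var), term_subst_var]
  intro v hv
  rw [Function.update_of_ne]
  rintro rfl
  exact h hv

theorem substTerm_var_self (x : ℕ) (s : L.Term ℕ) : Fml.substTerm x (Term.var x) s = s := by
  rw [Fml.substTerm, Function.update_eq_self, term_subst_var]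

theorem mem_varFinset_substTerm {x a : ℕ} {t s : L.Term ℕ}
    (h : a ∈ (Fml.substTerm x t s).varFinset) :
    (a ∈ s.varFinset ∧ a ≠ x) ∨ a ∈ t.varFinset := by
  obtain ⟨v, hv, ha⟩ := mem_varFinset_subst.1 h
  by_cases hx : v = x
  · subst hx; right; simpa using ha
  · rw [Function.update_of_ne hx] at ha
    simp only [Term.varFinset, Finset.mem_singleton] at ha
    subst ha
    exact .inl ⟨hv, hx⟩

theorem substTerm_substTerm {x l : ℕ} {s : L.Term ℕ} (h : l ∉ s.varFinset) :
    Fml.substTerm l (Term.var x) (Fml.substTerm x (Term.var l) s) = s := by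
  rw [Fml.substTerm, Fml.substTerm, term_subst_subst, term_subst_congr (τ := Term.var),
    term_subst_var]
  intro v hv
  by_cases hx : v = x
  · subst hx; simp [Term.subst]
  · have : v ≠ l := by rintro rfl; exact h hv
    simp [Function.update_of_ne hx, Term.subst, Function.update_of_ne this]

end Terms

/-! ### Syntax: substitution, capture and renaming of bound variables -/

namespace Fml

variable {L : FirstOrder.Language.{u, v}}

/-- The variables that stand next to a quantifier of a formula. -/
def boundVars : Fml L → Finset ℕ
  | eq _ _ => ∅
  | rel _ _ => ∅
  | and φ ψ => φ.boundVars ∪ ψ.boundVars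
  | not φ => φ.boundVars
  | all x φ => insert x φ.boundVars

/-- The number of logical symbols of a formula. -/
def size : Fml L → ℕ
  | eq _ _ => 0
  | rel _ _ => 0
  | and φ ψ => φ.size + ψ.size + 1
  | not φ => φ.size + 1
  | all _ φ => φ.size + 1

theorem freeVars_subset_vars (φ : Fml L) : φ.freeVars ⊆ φ.vars := by
  induction φ with
  | eq | rel => exact subset_rfl
  | and φ ψ h₁ h₂ => exact Finset.union_subset_union h₁ h₂
  | not φ h => exact h
  | all x φ h =>
    exact (Finset.erase_subset _ _).trans (h.trans (Finset.subset_insert _ _))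

theorem boundVars_subset_vars (φ : Fml L) : φ.boundVars ⊆ φ.vars := by
  induction φ with
  | eq | rel => simp [boundVars]
  | and φ ψ h₁ h₂ => exact Finset.union_subset_union h₁ h₂
  | not φ h => exact h
  | all x φ h => exact Finset.insert_subset_insert _ h

theorem freshVar_notMem (φ : Fml L) : φ.freshVar ∉ φ.vars :=
  Nat.sInf_mem (s := {l : ℕ | l ∉ φ.vars}) (Infinite.exists_notMem_finset φ.vars)

theorem subst_of_notMem {x : ℕ} {t : L.Term ℕ} {φ : Fml L} (h : x ∉ φ.freeVars) :
    φ.subst x t = φ := by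
  induction φ with
  | eq s₁ s₂ =>
    simp only [freeVars, Finset.mem_union, not_or] at h
    simp [subst, substTerm_of_notMem h.1, substTerm_of_notMem h.2]
  | rel R ts =>
    simp only [freeVars, Finset.mem_biUnion, Finset.mem_univ, true_and, not_exists] at h
    simp [subst, substTerm_of_notMem (h _)]
  | and φ ψ h₁ h₂ =>
    simp only [freeVars, Finset.mem_union, not_or] at h
    simp [subst, h₁ h.1, h₂ h.2]
  | not φ ih => simp [subst, ih h]
  | all y φ ih =>
    by_cases hy : y = x
    · simp [subst, hy]
    · simp only [freeVars, Finset.mem_erase, not_and] at h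
      simp [subst, hy, ih (h (Ne.symm hy))]

theorem subst_var_self (x : ℕ) (φ : Fml L) : φ.subst x (Term.var x) = φ := by
  induction φ with
  | eq | rel => simp [subst, substTerm_var_self]
  | and φ ψ h₁ h₂ => simp [subst, h₁, h₂]
  | not φ ih => simp [subst, ih]
  | all y φ ih => simp [subst, ih]

theorem mem_freeVars_subst {x a : ℕ} {t : L.Term ℕ} {φ : Fml L}
    (h : a ∈ (φ.subst x t).freeVars) : (a ∈ φ.freeVars ∧ a ≠ x) ∨ a ∈ t.varFinset := by
  induction φ with
  | eq s₁ s₂ =>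
    simp only [subst, freeVars, Finset.mem_union] at h ⊢
    rcases h with h | h <;> rcases mem_varFinset_substTerm h with h | h <;> tauto
  | rel R ts =>
    simp only [subst, freeVars, Finset.mem_biUnion, Finset.mem_univ, true_and] at h ⊢
    obtain ⟨i, h⟩ := h
    rcases mem_varFinset_substTerm h with h | h
    · exact .inl ⟨⟨i, h.1⟩, h.2⟩
    · exact .inr h
  | and φ ψ h₁ h₂ =>
    simp only [subst, freeVars, Finset.mem_union] at h ⊢
    tauto
  | not φ ih => exact ih h
  | all y φ ih =>
    by_cases hy : y = x
    · subst hy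
      simp only [subst, if_true, freeVars, Finset.mem_erase] at h ⊢
      tauto
    · simp only [subst, hy, if_false, freeVars, Finset.mem_erase] at h ⊢
      tauto

theorem boundVars_subst (x : ℕ) (t : L.Term ℕ) (φ : Fml L) :
    (φ.subst x t).boundVars = φ.boundVars := by
  induction φ with
  | eq | rel => rfl
  | and φ ψ h₁ h₂ => simp [subst, boundVars, h₁, h₂]
  | not φ ih => simp [subst, boundVars, ih]
  | all y φ ih => by_cases hy : y = x <;> simp [subst, hy, boundVars, ih]

theorem freeFor_of_notMem_boundVars {x : ℕ} {t : L.Term ℕ} {φ : Fml L}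
    (h : ∀ v ∈ t.varFinset, v ∉ φ.boundVars) : φ.FreeFor x t := by
  induction φ with
  | eq | rel => trivial
  | and φ ψ h₁ h₂ =>
    simp only [boundVars, Finset.mem_union, not_or] at h
    exact ⟨h₁ fun v hv => (h v hv).1, h₂ fun v hv => (h v hv).2⟩
  | not φ ih => exact ih h
  | all y φ ih =>
    simp only [boundVars, Finset.mem_insert, not_or] at h
    exact .inr ⟨fun hy => (h y hy).1 rfl, ih fun v hv => (h v hv).2⟩

theorem freeFor_var_of_notMem {x p : ℕ} {φ : Fml L} (h : p ∉ φ.boundVars) :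
    φ.FreeFor x (Term.var p) :=
  freeFor_of_notMem_boundVars fun v hv => by
    simp only [Term.varFinset, Finset.mem_singleton] at hv; exact hv ▸ h

theorem freeFor_var_self (x : ℕ) (φ : Fml L) : φ.FreeFor x (Term.var x) := by
  induction φ with
  | eq | rel => trivial
  | and φ ψ h₁ h₂ => exact ⟨h₁, h₂⟩
  | not φ ih => exact ih
  | all y φ ih =>
    by_cases hy : y = x
    · left; simp [freeVars, hy]
    · right; simpa [Term.varFinset, hy] using ih

/-- The free occurrences of `l` after the first substitution are exactly the former free occurrences
of `x`. This makes a change of bound variable reversible. -/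
theorem subst_subst_var {x l : ℕ} {φ : Fml L} (hl : l ∉ φ.freeVars)
    (h : φ.FreeFor x (Term.var l)) :
    (φ.subst x (Term.var l)).subst l (Term.var x) = φ := by
  induction φ with
  | eq s₁ s₂ =>
    simp only [freeVars, Finset.mem_union, not_or] at hl
    simp [subst, substTerm_substTerm hl.1, substTerm_substTerm hl.2]
  | rel R ts =>
    simp only [freeVars, Finset.mem_biUnion, Finset.mem_univ, true_and, not_exists] at hl
    simp [subst, substTerm_substTerm (hl _)]
  | and φ ψ h₁ h₂ =>
    simp only [freeVars, Finset.mem_union, not_or] at hl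
    simp [subst, h₁ hl.1 h.1, h₂ hl.2 h.2]
  | not φ ih => simp [subst, ih hl h]
  | all y φ ih =>
    rcases h with h | ⟨hy, h⟩
    · rw [subst_of_notMem h, subst_of_notMem hl]
    · simp only [Term.varFinset, Finset.mem_singleton] at hy
      by_cases hx : y = x
      · have : x ∉ (all y φ).freeVars := by simp [freeVars, hx]
        rw [subst_of_notMem this, subst_of_notMem hl]
      · simp only [freeVars, Finset.mem_erase, not_and] at hl
        simp [subst, hx, hy, ih (hl (Ne.symm hy)) h]

theorem freeFor_subst_var {x l : ℕ} {φ : Fml L} (hl : l ∉ φ.freeVars)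
    (h : φ.FreeFor x (Term.var l)) :
    (φ.subst x (Term.var l)).FreeFor l (Term.var x) := by
  induction φ with
  | eq | rel => trivial
  | and φ ψ h₁ h₂ =>
    simp only [freeVars, Finset.mem_union, not_or] at hl
    exact ⟨h₁ hl.1 h.1, h₂ hl.2 h.2⟩
  | not φ ih => exact ih hl h
  | all y φ ih =>
    rcases h with h | ⟨hy, h⟩
    · rw [subst_of_notMem h]
      exact .inl hl
    · simp only [Term.varFinset, Finset.mem_singleton] at hy
      by_cases hx : y = x
      · have : x ∉ (all y φ).freeVars := by simp [freeVars, hx]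
        rw [subst_of_notMem this]
        exact .inl hl
      · simp only [freeVars, Finset.mem_erase, not_and] at hl
        simp only [subst, hx, if_false]
        exact .inr ⟨by simpa [Term.varFinset] using hx, ih (hl (Ne.symm hy)) h⟩

theorem size_subst (x : ℕ) (t : L.Term ℕ) (φ : Fml L) : (φ.subst x t).size = φ.size := by
  induction φ with
  | eq | rel => rfl
  | and φ ψ h₁ h₂ => simp [subst, size, h₁, h₂]
  | not φ ih => simp [subst, size, ih]
  | all y φ ih => by_cases hy : y = x <;> simp [subst, hy, size, ih]

theorem size_renameBound (p l : ℕ) (φ : Fml L) : (φ.renameBound p l).size = φ.size := by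
  induction φ with
  | eq | rel => rfl
  | and φ ψ h₁ h₂ => simp [renameBound, size, h₁, h₂]
  | not φ ih => simp [renameBound, size, ih]
  | all y φ ih => by_cases hy : y = p <;> simp [renameBound, hy, size, ih, size_subst]

/-- `φ(k/p)` need not be a subformula of `∀x_k.φ`, so the truth lemma inducts on size instead of
structure. -/
theorem size_inst (φ : Fml L) (k p : ℕ) : (φ.inst k p).size = φ.size := by
  rw [inst, size_subst, size_renameBound]

theorem renameBound_of_notMem {p l : ℕ} {φ : Fml L} (h : p ∉ φ.boundVars) :
    φ.renameBound p l = φ := by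
  induction φ with
  | eq | rel => rfl
  | and φ ψ h₁ h₂ =>
    simp only [boundVars, Finset.mem_union, not_or] at h
    simp [renameBound, h₁ h.1, h₂ h.2]
  | not φ ih => simp [renameBound, ih h]
  | all y φ ih =>
    simp only [boundVars, Finset.mem_insert, not_or] at h
    simp [renameBound, Ne.symm h.1, ih h.2]

theorem notMem_boundVars_renameBound {p l : ℕ} (hpl : p ≠ l) (φ : Fml L) :
    p ∉ (φ.renameBound p l).boundVars := by
  induction φ with
  | eq | rel => simp [renameBound, boundVars]
  | and φ ψ h₁ h₂ => simp [renameBound, boundVars, h₁, h₂]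
  | not φ ih => simpa [renameBound, boundVars] using ih
  | all y φ ih =>
    by_cases hy : y = p
    · simp [renameBound, hy, boundVars, boundVars_subst, hpl, ih]
    · simp [renameBound, hy, boundVars, ih, Ne.symm hy]

theorem freeVars_renameBound_subset (p l : ℕ) (φ : Fml L) :
    (φ.renameBound p l).freeVars ⊆ φ.freeVars := by
  induction φ with
  | eq | rel => simp [renameBound]
  | and φ ψ h₁ h₂ => exact Finset.union_subset_union h₁ h₂
  | not φ ih => exact ih
  | all y φ ih =>
    by_cases hy : y = p
    · subst hy
      intro a ha
      simp only [renameBound, if_true, freeVars, Finset.mem_erase] at ha ⊢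
      rcases mem_freeVars_subst ha.2 with h | h
      · exact ⟨h.2, ih h.1⟩
      · simp only [Term.varFinset, Finset.mem_singleton] at h
        exact absurd h ha.1
    · simp only [renameBound, hy, if_false, freeVars]
      exact Finset.erase_subset_erase _ ih

/-- A quantifier over `l` in the renamed formula stems from one over `p`; in its scope `p` has been
replaced, so no free `p` is left there to be captured. -/
theorem freeFor_renameBound {p l : ℕ} {φ : Fml L} (hl : l ∉ φ.vars) (hpl : p ≠ l) :
    (φ.renameBound p l).FreeFor p (Term.var l) := by
  induction φ with
  | eq | rel => trivial
  | and φ ψ h₁ h₂ =>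
    simp only [vars, Finset.mem_union, not_or] at hl
    exact ⟨h₁ hl.1, h₂ hl.2⟩
  | not φ ih => exact ih hl
  | all y φ ih =>
    simp only [vars, Finset.mem_insert, not_or] at hl
    by_cases hy : y = p
    · subst hy
      simp only [renameBound, if_true]
      left
      intro h
      simp only [freeVars, Finset.mem_erase] at h
      rcases mem_freeVars_subst h.2 with h' | h'
      · exact h'.2 rfl
      · simp only [Term.varFinset, Finset.mem_singleton] at h'
        exact hpl h'
    · simp only [renameBound, hy, if_false]
      exact .inr ⟨by simpa [Term.varFinset] using Ne.symm hl.1, ih hl.2⟩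

theorem freeFor_renameBound_freshVar (φ : Fml L) (k p : ℕ) :
    (φ.renameBound p φ.freshVar).FreeFor k (Term.var p) := by
  apply freeFor_var_of_notMem
  -- If `p` is itself the fresh variable, it does not occur in `φ` and the renaming does nothing.
  by_cases hp : p = φ.freshVar
  · have h : p ∉ φ.boundVars := fun h => φ.freshVar_notMem (hp ▸ φ.boundVars_subset_vars h)
    rwa [renameBound_of_notMem h]
  · exact notMem_boundVars_renameBound hp φ

theorem inst_of_notMem {φ : Fml L} {k p : ℕ} (h : p ∉ φ.boundVars) :
    φ.inst k p = φ.subst k (Term.var p) := by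
  rw [inst, renameBound_of_notMem h]

theorem inst_not (φ : Fml L) (k p : ℕ) : (not φ).inst k p = not (φ.inst k p) := rfl

end Fml

/-! ### Semantics of substitution and renaming -/

section Semantics

variable {L : FirstOrder.Language.{u, v}} {A : Type*} [L.Structure A]

theorem realize_congr {w w' : ℕ → A} {t : L.Term ℕ} (h : ∀ v ∈ t.varFinset, w v = w' v) :
    t.realize w = t.realize w' := by
  induction t with
  | var i => exact h i (by simp [Term.varFinset])
  | func f ts ih =>
    simp only [Term.realize]
    congr 1
    funext i
    exact ih i fun v hv => h v (by
      simp only [Term.varFinset, Finset.mem_biUnion, Finset.mem_univ, true_and]; exact ⟨i, hv⟩)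

theorem realize_substTerm (w : ℕ → A) (x : ℕ) (t s : L.Term ℕ) :
    (Fml.substTerm x t s).realize w = s.realize (Function.update w x (t.realize w)) := by
  rw [Fml.substTerm, Term.realize_subst]
  congr 1
  funext v
  by_cases hv : v = x
  · subst hv; simp
  · simp [Function.update_of_ne hv]

theorem holds_congr {w w' : ℕ → A} {φ : Fml L} (h : ∀ v ∈ φ.freeVars, w v = w' v) :
    Holds w φ ↔ Holds w' φ := by
  induction φ generalizing w w' with
  | eq s₁ s₂ =>
    simp only [Fml.freeVars, Finset.mem_union] at h
    simp only [Holds]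
    rw [realize_congr fun v hv => h v (.inl hv), realize_congr fun v hv => h v (.inr hv)]
  | rel R ts =>
    simp only [Fml.freeVars, Finset.mem_biUnion, Finset.mem_univ, true_and] at h
    simp only [Holds]
    rw [funext fun i => realize_congr fun v hv => h v ⟨i, hv⟩]
  | and φ ψ h₁ h₂ =>
    simp only [Fml.freeVars, Finset.mem_union] at h
    exact and_congr (h₁ fun v hv => h v (.inl hv)) (h₂ fun v hv => h v (.inr hv))
  | not φ ih => exact not_congr (ih h)
  | all y φ ih =>
    refine forall_congr' fun a => ih fun v hv => ?_
    by_cases hy : v = y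
    · subst hy; simp
    · rw [Function.update_of_ne hy, Function.update_of_ne hy]
      exact h v (by simp [Fml.freeVars, hy, hv])

/-- Freeness ensures that the quantifiers above a replaced occurrence do not change the value of
`t`. -/
theorem holds_subst {w : ℕ → A} {x : ℕ} {t : L.Term ℕ} {φ : Fml L} (h : φ.FreeFor x t) :
    Holds w (φ.subst x t) ↔ Holds (Function.update w x (t.realize w)) φ := by
  induction φ generalizing w with
  | eq s₁ s₂ => simp only [Fml.subst, Holds, realize_substTerm]
  | rel R ts => simp only [Fml.subst, Holds, realize_substTerm]
  | and φ ψ h₁ h₂ => exact and_congr (h₁ h.1) (h₂ h.2)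
  | not φ ih => exact not_congr (ih h)
  | all y φ ih =>
    by_cases hx : x ∈ (Fml.all y φ).freeVars
    · obtain ⟨hy, h⟩ := h.resolve_left (not_not_intro hx)
      have hyx : y ≠ x := by rintro rfl; simp [Fml.freeVars] at hx
      simp only [Fml.subst, hyx, if_false, Holds]
      refine forall_congr' fun a => ?_
      rw [ih h, Function.update_comm hyx.symm, realize_congr (w := Function.update w y a)]
      intro v hv
      rw [Function.update_of_ne]
      rintro rfl
      exact hy hv
    · rw [Fml.subst_of_notMem hx]
      refine holds_congr fun v hv => ?_
      rw [Function.update_of_ne]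
      rintro rfl
      exact hx hv

theorem holds_renameBound {w : ℕ → A} {p l : ℕ} {φ : Fml L} (hl : l ∉ φ.vars) :
    Holds w (φ.renameBound p l) ↔ Holds w φ := by
  induction φ generalizing w with
  | eq | rel => rfl
  | and φ ψ h₁ h₂ =>
    simp only [Fml.vars, Finset.mem_union, not_or] at hl
    exact and_congr (h₁ hl.1) (h₂ hl.2)
  | not φ ih => exact not_congr (ih hl)
  | all y φ ih =>
    simp only [Fml.vars, Finset.mem_insert, not_or] at hl
    by_cases hy : y = p
    · subst hy
      simp only [Fml.renameBound, if_true, Holds]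
      refine forall_congr' fun a => ?_
      rw [holds_subst (Fml.freeFor_renameBound hl.2 (Ne.symm hl.1)), ih hl.2]
      refine holds_congr fun v hv => ?_
      have hvl : v ≠ l := by rintro rfl; exact hl.2 (φ.freeVars_subset_vars hv)
      by_cases hvy : v = y
      · subst hvy; simp
      · simp [Function.update_of_ne hvy, Function.update_of_ne hvl]
    · simp only [Fml.renameBound, hy, if_false, Holds]
      exact forall_congr' fun a => ih hl.2

theorem holds_inst {w : ℕ → A} {φ : Fml L} {k p : ℕ} :
    Holds w (φ.inst k p) ↔ Holds (Function.update w k (w p)) φ := by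
  rw [Fml.inst, holds_subst (φ.freeFor_renameBound_freshVar k p), Term.realize_var,
    holds_renameBound φ.freshVar_notMem]

end Semantics

/-! ### Quantifiers in the Lindenbaum algebra -/

section Calculus

variable {L : FirstOrder.Language.{u, v}} {T : Set (Fml L)}

theorem cls_all_le (x : ℕ) {t : L.Term ℕ} {φ : Fml L} (h : φ.FreeFor x t) :
    cls T (φ.all x) ≤ cls T (φ.subst x t) :=
  cls_le_cls.2 (.allElim φ x t h)

theorem cls_all_le_self (x : ℕ) (φ : Fml L) : cls T (φ.all x) ≤ cls T φ := by
  simpa only [Fml.subst_var_self] using cls_all_le (T := T) x (φ.freeFor_var_self x)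

theorem le_cls_all {x : ℕ} {φ ψ : Fml L} (hx : x ∉ ψ.freeVars) (h : cls T ψ ≤ cls T φ) :
    cls T ψ ≤ cls T (φ.all x) :=
  cls_le_cls.2 (.allIntro x hx (cls_le_cls.1 h))

theorem cls_all_mono (x : ℕ) {φ ψ : Fml L} (h : cls T φ ≤ cls T ψ) :
    cls T (φ.all x) ≤ cls T (ψ.all x) :=
  le_cls_all (by simp [Fml.freeVars]) ((cls_all_le_self x φ).trans h)

theorem cls_all_congr (x : ℕ) {φ ψ : Fml L} (h : cls T φ = cls T ψ) :
    cls T (φ.all x) = cls T (ψ.all x) :=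
  le_antisymm (cls_all_mono x h.le) (cls_all_mono x h.ge)

/-- Change of bound variable. Each side is instantiated and generalized to the other; one direction
relies on the back substitution from `l` to `x` restoring `φ`. -/
theorem cls_all_subst {x l : ℕ} {φ : Fml L} (hl : l ∉ φ.freeVars)
    (h : φ.FreeFor x (Term.var l)) :
    cls T ((φ.subst x (Term.var l)).all l) = cls T (φ.all x) := by
  by_cases hxl : x = l
  · subst hxl
    rw [Fml.subst_var_self]
  · apply le_antisymm
    · refine le_cls_all ?_ ?_
      · intro hx
        simp only [Fml.freeVars, Finset.mem_erase] at hx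
        rcases Fml.mem_freeVars_subst hx.2 with h' | h'
        · exact h'.2 rfl
        · simp only [Term.varFinset, Finset.mem_singleton] at h'
          exact hxl h'
      · have := cls_all_le (T := T) l (Fml.freeFor_subst_var hl h)
        rwa [Fml.subst_subst_var hl h] at this
    · refine le_cls_all ?_ (cls_all_le x h)
      simp [Fml.freeVars, hl]

theorem cls_renameBound {p l : ℕ} {φ : Fml L} (hl : l ∉ φ.vars) :
    cls T (φ.renameBound p l) = cls T φ := by
  induction φ with
  | eq | rel => rfl
  | and φ ψ h₁ h₂ =>
    simp only [Fml.vars, Finset.mem_union, not_or] at hl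
    simp only [Fml.renameBound, ← cls_inf_cls, h₁ hl.1, h₂ hl.2]
  | not φ ih => simp only [Fml.renameBound, ← compl_cls, ih hl]
  | all y φ ih =>
    simp only [Fml.vars, Finset.mem_insert, not_or] at hl
    by_cases hy : y = p
    · subst hy
      simp only [Fml.renameBound, if_true]
      rw [cls_all_subst (fun h => hl.2 (φ.freeVars_subset_vars
        (φ.freeVars_renameBound_subset _ _ h))) (Fml.freeFor_renameBound hl.2 (Ne.symm hl.1)),
        cls_all_congr y (ih hl.2)]
    · simp only [Fml.renameBound, hy, if_false]
      exact cls_all_congr y (ih hl.2)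

theorem cls_ex (k : ℕ) (φ : Fml L) : cls T (φ.ex k) = (cls T (φ.not.all k))ᶜ := rfl

theorem cls_ex_not (k : ℕ) (φ : Fml L) : cls T (φ.not.ex k) = (cls T (φ.all k))ᶜ := by
  rw [cls_ex, cls_all_congr k (φ := φ.not.not) (ψ := φ) (by
    rw [← compl_cls, ← compl_cls, compl_compl])]

theorem isLUB_instances (φ : Fml L) (k : ℕ) : IsLUB (instances T φ k) (cls T (φ.ex k)) := by
  constructor
  · rintro _ ⟨p, rfl⟩
    have h : cls T (φ.inst k p) ≤ cls T ((φ.renameBound p φ.freshVar).ex k) :=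
      cls_le_cls.2 (.exIntro _ k _ (φ.freeFor_renameBound_freshVar k p))
    refine h.trans_eq ?_
    rw [cls_ex, cls_ex, cls_all_congr k]
    rw [← compl_cls, ← compl_cls, cls_renameBound φ.freshVar_notMem]
  · rintro ⟨ψ⟩ hψ
    change cls T (φ.ex k) ≤ cls T ψ
    -- One instance at a variable foreign to both formulas suffices: in contraposed form, `ψ.not`
    -- has no free `p`, so the bound can be generalized over `p`, and `p` renamed to `k`.
    obtain ⟨p, hp⟩ := Infinite.exists_notMem_finset (φ.vars ∪ ψ.vars)
    simp only [Finset.mem_union, not_or] at hp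
    have hb : p ∉ φ.boundVars := fun h => hp.1 (φ.boundVars_subset_vars h)
    have hf : p ∉ φ.freeVars := fun h => hp.1 (φ.freeVars_subset_vars h)
    have h : cls T (φ.inst k p) ≤ cls T ψ := hψ ⟨p, rfl⟩
    rw [Fml.inst_of_notMem hb] at h
    rw [cls_ex, compl_le_iff_compl_le, compl_cls,
      ← cls_all_subst (x := k) (l := p) (φ := φ.not) hf (Fml.freeFor_var_of_notMem hb)]
    exact le_cls_all (fun h => hp.2 (ψ.freeVars_subset_vars h)) (compl_le_compl h)

end Calculus

/-! ### Ultrafilters and the Rasiowa–Sikorski lemma -/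

section Ultrafilters

variable {B : Type*} [BooleanAlgebra B]

theorem isUltra_of_mem_or_compl_mem {F : Order.PFilter B} (hbot : ⊥ ∉ F)
    (h : ∀ a, a ∈ F ∨ aᶜ ∈ F) : IsUltra F := by
  refine ⟨hbot, fun G hG hFG a ha => (h a).resolve_right fun hc => hG ?_⟩
  rw [← inf_compl_eq_bot (a := a)]
  exact Order.PFilter.inf_mem ha (hFG hc)

/-- If `aᶜ ∉ F`, the filter generated by `F` and `a` is proper, because `f ⊓ a = ⊥` would mean `f ≤
aᶜ`. Maximality then puts `a` in `F`. -/
theorem IsUltra.compl_mem_iff {F : Order.PFilter B} (hF : IsUltra F) (a : B) :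
    aᶜ ∈ F ↔ a ∉ F := by
  refine ⟨fun hc ha => hF.1 ?_, fun ha => ?_⟩
  · rw [← inf_compl_eq_bot (a := a)]
    exact Order.PFilter.inf_mem ha hc
  · have hG : Order.IsPFilter {x : B | ∃ f ∈ F, f ⊓ a ≤ x} := by
      refine .of_def ⟨⊤, ⊤, Order.PFilter.top_mem, le_top⟩ ?_ ?_
      · rintro x ⟨f, hf, hx⟩ y ⟨g, hg, hy⟩
        exact ⟨x ⊓ y, ⟨f ⊓ g, Order.PFilter.inf_mem hf hg,
          le_inf ((inf_le_inf_right a inf_le_left).trans hx)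
            ((inf_le_inf_right a inf_le_right).trans hy)⟩, inf_le_left, inf_le_right⟩
      · rintro x y hxy ⟨f, hf, hx⟩
        exact ⟨f, hf, hx.trans hxy⟩
    by_contra hc
    refine ha (hF.2 (y := hG.toPFilter) ?_ ?_ ?_)
    · rintro ⟨f, hf, h⟩
      exact hc (Order.PFilter.mem_of_le (le_compl_iff_disjoint_right.2 (disjoint_iff_inf_le.2 h)) hf)
    · exact fun f hf => ⟨f, hf, inf_le_left⟩
    · exact ⟨⊤, Order.PFilter.top_mem, inf_le_right⟩

/-- The **Rasiowa–Sikorski lemma**: in a countable nontrivial Boolean algebra there is an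
ultrafilter that preserves countably many given suprema. -/
theorem exists_isUltra_preservesSup [Nontrivial B] [Countable B] {ι : Type*} [Countable ι]
    (S : ι → Set B) (b : ι → B) (hS : ∀ i, IsLUB (S i) (b i)) :
    ∃ F : Order.PFilter B, IsUltra F ∧ ∀ i, PreservesSup F (S i) := by
  -- In the reversed order on nonzero elements, cofinal sets are the dense sets of forcing, and an
  -- ideal meeting them generates the required filter.
  let P := {a : B // a ≠ ⊥}ᵒᵈ
  let val : P → B := fun a => (OrderDual.ofDual a).1
  -- These sets decide the `i`-th supremum: an element either excludes `b i` or lies below a member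
  -- of `S i`.
  let 𝒟₁ : ι → Order.Cofinal P := fun i =>
    { carrier := {a | val a ≤ (b i)ᶜ ∨ ∃ s ∈ S i, val a ≤ s}
      isCofinal := by
        intro a
        by_cases h : ∃ s ∈ S i, val a ⊓ s ≠ ⊥
        · obtain ⟨s, hs, h⟩ := h
          exact ⟨OrderDual.toDual ⟨val a ⊓ s, h⟩, .inr ⟨s, hs, inf_le_right⟩,
            (inf_le_left : val a ⊓ s ≤ val a)⟩
        · push Not at h
          -- An element disjoint from all of `S i` has a complement bounding `S i`, hence bounding
          -- `b i`.
          refine ⟨a, .inl ?_, le_rfl⟩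
          rw [le_compl_comm]
          exact (hS i).2 fun s hs => le_compl_iff_disjoint_left.2 (disjoint_iff.2 (h s hs)) }
  -- Deciding every `c` makes the generated filter an ultrafilter.
  let 𝒟₂ : B → Order.Cofinal P := fun c =>
    { carrier := {a | val a ≤ c ∨ val a ≤ cᶜ}
      isCofinal := by
        intro a
        by_cases h : val a ⊓ c = ⊥
        · exact ⟨a, .inr (le_compl_iff_disjoint_right.2 (disjoint_iff.2 h)), le_rfl⟩
        · exact ⟨OrderDual.toDual ⟨val a ⊓ c, h⟩, .inl inf_le_right,
            (inf_le_left : val a ⊓ c ≤ val a)⟩ }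
  let _ := Encodable.ofCountable (ι ⊕ B)
  let I := Order.idealOfCofinals (OrderDual.toDual ⟨⊤, top_ne_bot⟩ : P) (Sum.elim 𝒟₁ 𝒟₂)
  have hF : Order.IsPFilter {x : B | ∃ a ∈ I, val a ≤ x} := by
    refine .of_def ⟨⊤, _, I.nonempty.some_mem, le_top⟩ ?_ ?_
    · rintro x ⟨a, ha, hx⟩ y ⟨c, hc, hy⟩
      obtain ⟨d, hd, had, hcd⟩ := I.directed a ha c hc
      exact ⟨val d, ⟨d, hd, le_rfl⟩, le_trans (show val d ≤ val a from had) hx,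
        le_trans (show val d ≤ val c from hcd) hy⟩
    · rintro x y hxy ⟨a, ha, hx⟩
      exact ⟨a, ha, hx.trans hxy⟩
  have hu : IsUltra hF.toPFilter := by
    refine isUltra_of_mem_or_compl_mem ?_ fun c => ?_
    · rintro ⟨a, -, h⟩
      exact (OrderDual.ofDual a).2 (le_bot_iff.1 h)
    · obtain ⟨a, ha, haI⟩ := Order.cofinal_meets_idealOfCofinals _ (Sum.elim 𝒟₁ 𝒟₂) (.inr c)
      exact Or.imp (fun h => ⟨a, haI, h⟩) (fun h => ⟨a, haI, h⟩) ha
  refine ⟨hF.toPFilter, hu, fun i => ⟨b i, hS i, fun hb => ?_, ?_⟩⟩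
  · obtain ⟨a, ha, haI⟩ := Order.cofinal_meets_idealOfCofinals _ (Sum.elim 𝒟₁ 𝒟₂) (.inl i)
    rcases ha with ha | ⟨s, hs, ha⟩
    · exact absurd hb ((hu.compl_mem_iff _).1 ⟨a, haI, ha⟩)
    · exact ⟨s, hs, a, haI, ha⟩
  · rintro ⟨s, hs, h⟩
    exact Order.PFilter.mem_of_le ((hS i).1 hs) h

end Ultrafilters

/-! ### Countability of the language and existence of the ultrafilter -/

section Countability

variable {L : FirstOrder.Language.{u, v}}

theorem countable_setOf_size_le [Countable (Σ n, L.Functions n)] [Countable (Σ n, L.Relations n)]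
    (n : ℕ) : {φ : Fml L | φ.size ≤ n}.Countable := by
  have hrel : Countable (Σ R : (Σ n, L.Relations n), Fin R.1 → L.Term ℕ) := inferInstance
  have h₀ : (Set.range (fun p : L.Term ℕ × L.Term ℕ => Fml.eq p.1 p.2) ∪
      Set.range (fun p : (Σ R : (Σ n, L.Relations n), Fin R.1 → L.Term ℕ) =>
        Fml.rel p.1.2 p.2)).Countable :=
    (Set.countable_range _).union (Set.countable_range _)
  induction n with
  | zero =>
    refine h₀.mono fun φ hφ => ?_
    cases φ with
    | eq s t => exact .inl ⟨(s, t), rfl⟩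
    | rel R ts => exact .inr ⟨⟨⟨_, R⟩, ts⟩, rfl⟩
    | and | not | all => simp [Fml.size] at hφ
  | succ n ih =>
    refine (((h₀.union (ih.image2 ih Fml.and)).union (ih.image Fml.not)).union
      ((Set.countable_univ (α := ℕ)).image2 ih Fml.all)).mono fun φ hφ => ?_
    cases φ with
    | eq s t => exact .inl (.inl (.inl (.inl ⟨(s, t), rfl⟩)))
    | rel R ts => exact .inl (.inl (.inl (.inr ⟨⟨⟨_, R⟩, ts⟩, rfl⟩)))
    | and φ ψ =>
      simp only [Set.mem_ofPred_eq, Fml.size] at hφ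
      exact .inl (.inl (.inr ⟨φ, by simp only [Set.mem_ofPred_eq]; omega, ψ,
        by simp only [Set.mem_ofPred_eq]; omega, rfl⟩))
    | not φ =>
      simp only [Set.mem_ofPred_eq, Fml.size] at hφ
      exact .inl (.inr ⟨φ, by simp only [Set.mem_ofPred_eq]; omega, rfl⟩)
    | all x φ =>
      simp only [Set.mem_ofPred_eq, Fml.size] at hφ
      exact .inr ⟨x, trivial, φ, by simp only [Set.mem_ofPred_eq]; omega, rfl⟩

instance [Countable (Σ n, L.Functions n)] [Countable (Σ n, L.Relations n)] :
    Countable (Fml L) := by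
  rw [← Set.countable_univ_iff]
  refine (Set.countable_iUnion (countable_setOf_size_le (L := L))).mono fun φ _ => ?_
  exact Set.mem_iUnion.2 ⟨φ.size, le_refl φ.size⟩

theorem Consistent.nontrivial {T : Set (Fml L)} (h : Consistent T) : Nontrivial (Lindenbaum T) := by
  rw [Consistent, not_forall] at h
  obtain ⟨φ, hφ⟩ := h
  exact ⟨cls T φ, ⊤, fun h => hφ (cls_eq_top.1 h)⟩

theorem exists_isUltra_preservesQuantifiers [Countable (Σ n, L.Functions n)]
    [Countable (Σ n, L.Relations n)] {T : Set (Fml L)} (h : Consistent T) :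
    ∃ F : Order.PFilter (Lindenbaum T), IsUltra F ∧ PreservesQuantifiers F := by
  have := h.nontrivial
  have : Countable (Lindenbaum T) := inferInstanceAs (Countable (Quotient _))
  obtain ⟨F, hF, hS⟩ := exists_isUltra_preservesSup
    (fun i : Fml L × ℕ => instances T i.1 i.2) _ fun i => isLUB_instances i.1 i.2
  exact ⟨F, hF, fun φ k => hS (φ, k)⟩

end Countability

/-! ### Simultaneous substitution in quantifier-free formulas -/

namespace Fml

variable {L : FirstOrder.Language.{u, v}}

/-- Simultaneous substitution of terms for the variables of a quantifier-free formula. Formulas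
`∀ x. φ` are left unchanged. -/
def qfSubst (σ : ℕ → L.Term ℕ) : Fml L → Fml L
  | eq s₁ s₂ => eq (s₁.subst σ) (s₂.subst σ)
  | rel R ts => rel R fun i => (ts i).subst σ
  | and φ ψ => and (qfSubst σ φ) (qfSubst σ ψ)
  | not φ => not (qfSubst σ φ)
  | all y φ => all y φ

theorem boundVars_qfSubst (σ : ℕ → L.Term ℕ) (φ : Fml L) :
    (φ.qfSubst σ).boundVars = φ.boundVars := by
  induction φ with
  | eq | rel | all => rfl
  | and φ ψ h₁ h₂ => simp [qfSubst, boundVars, h₁, h₂]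
  | not φ ih => simp [qfSubst, boundVars, ih]

theorem subst_eq_qfSubst {x : ℕ} {t : L.Term ℕ} {φ : Fml L} (h : φ.boundVars = ∅) :
    φ.subst x t = φ.qfSubst (Function.update Term.var x t) := by
  induction φ with
  | eq | rel => rfl
  | and φ ψ h₁ h₂ =>
    simp only [boundVars, Finset.union_eq_empty] at h
    simp [subst, qfSubst, h₁ h.1, h₂ h.2]
  | not φ ih => simp [subst, qfSubst, ih h]
  | all y φ ih => simp [boundVars] at h

theorem qfSubst_var (φ : Fml L) : φ.qfSubst Term.var = φ := by
  induction φ with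
  | eq | rel => simp [qfSubst, term_subst_var]
  | and φ ψ h₁ h₂ => simp [qfSubst, h₁, h₂]
  | not φ ih => simp [qfSubst, ih]
  | all => rfl

theorem qfSubst_congr {σ τ : ℕ → L.Term ℕ} {φ : Fml L} (h : ∀ v ∈ φ.vars, σ v = τ v) :
    φ.qfSubst σ = φ.qfSubst τ := by
  induction φ with
  | eq s₁ s₂ =>
    simp only [vars, Finset.mem_union] at h
    simp only [qfSubst]
    rw [term_subst_congr _ fun v hv => h v (.inl hv), term_subst_congr _ fun v hv => h v (.inr hv)]
  | rel R ts =>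
    simp only [vars, Finset.mem_biUnion, Finset.mem_univ, true_and] at h
    simp only [qfSubst]
    rw [funext fun i => term_subst_congr _ fun v hv => h v ⟨i, hv⟩]
  | and φ ψ h₁ h₂ =>
    simp only [vars, Finset.mem_union] at h
    simp only [qfSubst]
    rw [h₁ fun v hv => h v (.inl hv), h₂ fun v hv => h v (.inr hv)]
  | not φ ih => simp only [qfSubst, ih h]
  | all => rfl

theorem qfSubst_qfSubst (σ τ : ℕ → L.Term ℕ) (φ : Fml L) :
    (φ.qfSubst σ).qfSubst τ = φ.qfSubst fun v => (σ v).subst τ := by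
  induction φ with
  | eq | rel => simp [qfSubst, term_subst_subst]
  | and φ ψ h₁ h₂ => simp [qfSubst, h₁, h₂]
  | not φ ih => simp [qfSubst, ih]
  | all => rfl

theorem boundVars_foldr_imp {l : List (Fml L)} {φ : Fml L} (hl : ∀ ψ ∈ l, ψ.boundVars = ∅)
    (h : φ.boundVars = ∅) : (l.foldr imp φ).boundVars = ∅ := by
  induction l with
  | nil => exact h
  | cons ψ l ih =>
    simp only [List.mem_cons, forall_eq_or_imp] at hl
    simp [imp, or, boundVars, hl.1, ih hl.2]

theorem boundVars_eqChain {n : ℕ} (y z : Fin n → ℕ) {φ : Fml L} (h : φ.boundVars = ∅) :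
    (eqChain y z φ).boundVars = ∅ := by
  refine boundVars_foldr_imp (fun ψ hψ => ?_) h
  obtain ⟨i, rfl⟩ := List.mem_ofFn.1 hψ
  rfl

theorem qfSubst_foldr_imp (σ : ℕ → L.Term ℕ) (l : List (Fml L)) (φ : Fml L) :
    (l.foldr imp φ).qfSubst σ = (l.map (qfSubst σ)).foldr imp (φ.qfSubst σ) := by
  induction l with
  | nil => rfl
  | cons ψ l ih => simp [imp, or, qfSubst, ← ih]

end Fml

/-! ### Closure of provability under substitution -/

section Substitution

variable {L : FirstOrder.Language.{u, v}} {T : Set (Fml L)}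

/-- When no inserted term contains a variable of `S`, replacing these variables one at a time
amounts to replacing them simultaneously. Each single replacement is a generalization followed by
`allElim`; without quantifiers there is no capture. -/
theorem Provable.qfSubst_of_disjoint {φ : Fml L} (h : Provable T φ) (hφ : φ.boundVars = ∅)
    (σ : ℕ → L.Term ℕ) (S : Finset ℕ) (hS : ∀ a ∈ S, ∀ v ∈ S, a ∉ (σ v).varFinset) :
    Provable T (φ.qfSubst fun v => if v ∈ S then σ v else Term.var v) := by
  induction S using Finset.induction_on with
  | empty => simpa [Fml.qfSubst_var] using h
  | insert a S ha ih =>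
    have ih := ih fun b hb v hv => hS b (Finset.mem_insert_of_mem hb) v (Finset.mem_insert_of_mem hv)
    have hb := (Fml.boundVars_qfSubst (fun v => if v ∈ S then σ v else Term.var v) φ).trans hφ
    have h' := Provable.modusPonens (.generalization a ih)
      (.allElim _ a (σ a) (Fml.freeFor_of_notMem_boundVars fun v _ => by simp [hb]))
    rw [Fml.subst_eq_qfSubst hb, Fml.qfSubst_qfSubst] at h'
    convert h' using 3 with v
    by_cases hv : v ∈ S
    · rw [if_pos (Finset.mem_insert_of_mem hv), if_pos hv]
      exact (substTerm_of_notMem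
        (hS a (Finset.mem_insert_self a S) v (Finset.mem_insert_of_mem hv))).symm
    · by_cases hva : v = a
      · subst hva
        simp [hv, Term.subst]
      · simp [hv, hva, Term.subst]

theorem Provable.qfSubst {φ : Fml L} (h : Provable T φ) (hφ : φ.boundVars = ∅)
    (σ : ℕ → L.Term ℕ) : Provable T (φ.qfSubst σ) := by
  -- Disjointness is forced by a detour: first move every variable `v` of `φ` to `v + (N + 1)`,
  -- beyond all variables involved, then replace the moved variable by `σ v`.
  obtain ⟨N, hN⟩ := (φ.vars ∪ φ.vars.biUnion fun v => (σ v).varFinset).bddAbove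
  have hN₁ : ∀ v ∈ φ.vars, v ≤ N := fun v hv => hN (by simp [hv])
  have hN₂ : ∀ v ∈ φ.vars, ∀ a ∈ (σ v).varFinset, a ≤ N := fun v hv a ha => hN (by
    simp only [Finset.coe_union, Set.mem_union, Finset.mem_coe, Finset.mem_biUnion]
    exact .inr ⟨v, hv, ha⟩)
  have h₁ := h.qfSubst_of_disjoint hφ (fun v => Term.var (v + (N + 1))) φ.vars fun a ha v _ => by
    have := hN₁ a ha
    simp only [Term.varFinset, Finset.mem_singleton]
    omega
  have h₂ := h₁.qfSubst_of_disjoint (by rw [Fml.boundVars_qfSubst, hφ]) (fun v => σ (v - (N + 1)))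
    (φ.vars.image (· + (N + 1))) (by
      simp only [Finset.mem_image]
      rintro _ ⟨a, _, rfl⟩ _ ⟨v, hv, rfl⟩ h
      rw [Nat.add_sub_cancel] at h
      have := hN₂ v hv _ h
      omega)
  rw [Fml.qfSubst_qfSubst] at h₂
  rwa [Fml.qfSubst_congr (τ := σ)] at h₂
  intro v hv
  rw [if_pos hv]
  simp only [Term.subst]
  rw [if_pos (Finset.mem_image_of_mem _ hv), Nat.add_sub_cancel]

end Substitution

/-! ### Equality modulo the filter, the term model and the truth lemma -/

section TermModel

variable {L : FirstOrder.Language.{u, v}} {T : Set (Fml L)} {F : Order.PFilter (Lindenbaum T)}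

theorem Provable.cls_mem {φ : Fml L} (h : Provable T φ) : cls T φ ∈ F := by
  rw [cls_eq_top.2 h]
  exact Order.PFilter.top_mem

theorem cls_mem_of_imp {φ ψ : Fml L} (h : cls T (φ.imp ψ) ∈ F) (hφ : cls T φ ∈ F) :
    cls T ψ ∈ F := by
  refine Order.PFilter.mem_of_le ?_ (Order.PFilter.inf_mem hφ h)
  change cls T φ ⊓ ((cls T φ)ᶜ ⊔ cls T ψ) ≤ cls T ψ
  rw [inf_sup_left, inf_compl_eq_bot, bot_sup_eq]
  exact inf_le_right

theorem cls_mem_of_foldr_imp {l : List (Fml L)} {φ : Fml L} (h : cls T (l.foldr Fml.imp φ) ∈ F)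
    (hl : ∀ ψ ∈ l, cls T ψ ∈ F) : cls T φ ∈ F := by
  induction l with
  | nil => exact h
  | cons ψ l ih =>
    simp only [List.mem_cons, forall_eq_or_imp] at hl
    exact ih (cls_mem_of_imp h hl.1) hl.2

theorem cls_mem_of_eqChain {n : ℕ} {y z : Fin n → ℕ} {φ : Fml L}
    (h : Provable T (Fml.eqChain y z φ)) (hφ : φ.boundVars = ∅) (σ : ℕ → L.Term ℕ)
    (hσ : ∀ i, cls T (Fml.eq (σ (y i)) (σ (z i))) ∈ F) : cls T (φ.qfSubst σ) ∈ F := by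
  have h' := h.qfSubst (Fml.boundVars_eqChain y z hφ) σ
  rw [Fml.eqChain, Fml.qfSubst_foldr_imp] at h'
  refine cls_mem_of_foldr_imp h'.cls_mem fun ψ hψ => ?_
  obtain ⟨χ, hχ, rfl⟩ := List.mem_map.1 hψ
  obtain ⟨i, rfl⟩ := List.mem_ofFn.1 hχ
  exact hσ i

/-- Lets an equality axiom stated for the variables `0, …, n - 1` and `n, …, 2n - 1` be specialized
to two arbitrary tuples of terms. -/
theorem exists_subst_extending {n : ℕ} (t s : Fin n → L.Term ℕ) :
    ∃ σ : ℕ → L.Term ℕ, (∀ i : Fin n, σ i = t i) ∧ ∀ i : Fin n, σ (n + i) = s i := by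
  refine ⟨fun v => if h : v < n then t ⟨v, h⟩ else
    if h : v - n < n then s ⟨v - n, h⟩ else Term.var v, fun i => ?_, fun i => ?_⟩ <;> simp

theorem func_congr {n : ℕ} (f : L.Functions n) {t s : Fin n → L.Term ℕ}
    (h : ∀ i, cls T (Fml.eq (t i) (s i)) ∈ F) :
    cls T (Fml.eq (Term.func f t) (Term.func f s)) ∈ F := by
  obtain ⟨σ, h₁, h₂⟩ := exists_subst_extending t s
  have := cls_mem_of_eqChain (F := F) (.eqFun f (fun i => (i : ℕ)) fun i => n + i) rfl σ
    fun i => by rw [h₁, h₂]; exact h i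
  simpa only [Fml.qfSubst, Term.subst, h₁, h₂] using this

theorem rel_congr {n : ℕ} (R : L.Relations n) {t s : Fin n → L.Term ℕ}
    (h : ∀ i, cls T (Fml.eq (t i) (s i)) ∈ F) (ht : cls T (Fml.rel R t) ∈ F) :
    cls T (Fml.rel R s) ∈ F := by
  obtain ⟨σ, h₁, h₂⟩ := exists_subst_extending t s
  have := cls_mem_of_eqChain (F := F) (.eqRel R (fun i => (i : ℕ)) fun i => n + i) rfl σ
    fun i => by rw [h₁, h₂]; exact h i
  simp only [Fml.imp, Fml.or, Fml.qfSubst, Term.subst, h₁, h₂] at this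
  exact cls_mem_of_imp this ht

theorem provable_eq_refl (t : L.Term ℕ) : Provable T (Fml.eq t t) :=
  (Provable.identity 0).qfSubst rfl fun _ => t

theorem eq_congr {a b c d : L.Term ℕ} (hac : cls T (Fml.eq a c) ∈ F)
    (hbd : cls T (Fml.eq b d) ∈ F) (hab : cls T (Fml.eq a b) ∈ F) : cls T (Fml.eq c d) ∈ F := by
  have h := (Provable.eqEq (T := T) 0 1 2 3).qfSubst rfl fun
    | 0 => a
    | 1 => b
    | 2 => c
    | _ => d
  exact cls_mem_of_imp (cls_mem_of_imp (cls_mem_of_imp h.cls_mem hac) hbd) hab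

theorem eq_symm_mem {t s : L.Term ℕ} (h : cls T (Fml.eq t s) ∈ F) : cls T (Fml.eq s t) ∈ F :=
  eq_congr h (provable_eq_refl t).cls_mem (provable_eq_refl t).cls_mem

theorem eq_trans_mem {t s r : L.Term ℕ} (h₁ : cls T (Fml.eq t s) ∈ F)
    (h₂ : cls T (Fml.eq s r) ∈ F) : cls T (Fml.eq t r) ∈ F :=
  eq_congr (provable_eq_refl t).cls_mem h₂ h₁

theorem hat_eq_hat {i j : ℕ} : hat F i = hat F j ↔ cls T (Fml.varEq i j) ∈ F :=
  ⟨fun h => Quotient.exact h, fun h => Quotient.sound h⟩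

theorem PreservesQuantifiers.ex_mem_iff (hF : PreservesQuantifiers F) (φ : Fml L) (k : ℕ) :
    cls T (φ.ex k) ∈ F ↔ ∃ p, cls T (φ.inst k p) ∈ F := by
  obtain ⟨b, hb, h⟩ := hF φ k
  rw [(isLUB_instances φ k).unique hb, h]
  simp [instances]

/-- For `k` not in `t`, `∃x_k. t == x_k` follows from `t == t`; preservation of its supremum yields
a witnessing variable. -/
theorem PreservesQuantifiers.exists_eq_var (hF : PreservesQuantifiers F) (t : L.Term ℕ) :
    ∃ j, cls T (Fml.eq t (Term.var j)) ∈ F := by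
  obtain ⟨k, hk⟩ := Infinite.exists_notMem_finset t.varFinset
  have h := Provable.exIntro (T := T) (Fml.eq t (Term.var k)) k t trivial
  have hs : (Fml.eq t (Term.var k)).subst k t = Fml.eq t t := by
    rw [Fml.subst, substTerm_of_notMem hk]
    simp [Fml.substTerm, Term.subst]
  rw [hs] at h
  obtain ⟨p, hp⟩ := (hF.ex_mem_iff _ _).1
    (Provable.modusPonens (provable_eq_refl t) h).cls_mem
  refine ⟨p, ?_⟩
  rw [Fml.inst_of_notMem (by simp [Fml.boundVars])] at hp
  rw [Fml.subst, substTerm_of_notMem hk] at hp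
  simpa [Fml.substTerm, Term.subst] using hp

theorem IsTermModel.realize_eq_hat {S : L.Structure (Carrier F)} (hS : IsTermModel F S)
    {t : L.Term ℕ} {j : ℕ} (h : cls T (Fml.eq t (Term.var j)) ∈ F) :
    t.realize (hat F) = hat F j := by
  cases t with
  | var i => exact hat_eq_hat.2 h
  | func f ts => exact hS.funMap_eq f ts j h

theorem IsTermModel.realize_eq_realize (hF : PreservesQuantifiers F)
    {S : L.Structure (Carrier F)} (hS : IsTermModel F S) (t s : L.Term ℕ) :
    t.realize (hat F) = s.realize (hat F) ↔ cls T (Fml.eq t s) ∈ F := by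
  obtain ⟨i, hi⟩ := hF.exists_eq_var t
  obtain ⟨j, hj⟩ := hF.exists_eq_var s
  rw [hS.realize_eq_hat hi, hS.realize_eq_hat hj, hat_eq_hat]
  exact ⟨fun h => eq_trans_mem (eq_trans_mem hi h) (eq_symm_mem hj),
    fun h => eq_trans_mem (eq_symm_mem hi) (eq_trans_mem h hj)⟩

/-- The index of a variable in a given class of the term model. -/
noncomputable def rep (a : Carrier F) : ℕ := Quotient.out a

theorem hat_rep (a : Carrier F) : hat F (rep a) = a := Quotient.out_eq a

/-- The interpretation of the symbols of `L` in the term model of `F`. -/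
@[reducible]
noncomputable def termStructure (hF : PreservesQuantifiers F) : L.Structure (Carrier F) where
  funMap f a := hat F (hF.exists_eq_var (Term.func f fun i => Term.var (rep (a i)))).choose
  RelMap R a := cls T (Fml.rel R fun i => Term.var (rep (a i))) ∈ F

/-- By induction each argument is `F`-equal to the representative of its value, so congruence makes
the choice of representatives in `termStructure` harmless. -/
theorem termStructure_realize (hF : PreservesQuantifiers F) (t : L.Term ℕ) (j : ℕ) :
    letI := termStructure hF
    t.realize (hat F) = hat F j ↔ cls T (Fml.eq t (Term.var j)) ∈ F := by
  let _ := termStructure hF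
  induction t generalizing j with
  | var i => exact hat_eq_hat
  | func f ts ih =>
    have h := (hF.exists_eq_var (Term.func f fun i =>
      Term.var (rep ((ts i).realize (hat F))))).choose_spec
    have hc : cls T (Fml.eq (Term.func f ts) (Term.func f fun i =>
        Term.var (rep ((ts i).realize (hat F))))) ∈ F :=
      func_congr f fun i => (ih i _).1 (hat_rep _).symm
    refine Iff.trans (hat_eq_hat (F := F)) ⟨fun h' => ?_, fun h' => ?_⟩
    · exact eq_trans_mem (eq_trans_mem hc h) h'
    · exact eq_trans_mem (eq_symm_mem (eq_trans_mem hc h)) h'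

theorem isTermModel_termStructure (hF : PreservesQuantifiers F) :
    IsTermModel F (termStructure hF) := by
  let _ := termStructure hF
  refine ⟨fun f ts j h => (termStructure_realize hF (Term.func f ts) j).2 h, fun R ts => ?_⟩
  have hc : ∀ i, cls T (Fml.eq (ts i) (Term.var (rep ((ts i).realize (hat F))))) ∈ F :=
    fun i => (termStructure_realize hF (ts i) _).1 (hat_rep _).symm
  exact ⟨fun h => rel_congr R (fun i => eq_symm_mem (hc i)) h, fun h => rel_congr R hc h⟩

/-- Every tuple of the carrier consists of classes of variables, so the defining clauses at
variables already determine the structure. -/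
theorem IsTermModel.unique (hF : PreservesQuantifiers F) {S S' : L.Structure (Carrier F)}
    (hS : IsTermModel F S) (hS' : IsTermModel F S') : S = S' := by
  have hvar : ∀ {n : ℕ} (a : Fin n → Carrier F), ∃ y : Fin n → ℕ, a = fun i => hat F (y i) :=
    fun a => ⟨fun i => rep (a i), funext fun i => (hat_rep (a i)).symm⟩
  refine Structure.ext ?_ ?_
  · funext n f a
    obtain ⟨y, rfl⟩ := hvar a
    obtain ⟨j, hj⟩ := hF.exists_eq_var (Term.func f fun i => Term.var (y i))
    exact (hS.funMap_eq f _ j hj).trans (hS'.funMap_eq f _ j hj).symm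
  · funext n R a
    obtain ⟨y, rfl⟩ := hvar a
    exact propext ((hS.relMap_iff R fun i => Term.var (y i)).trans
      (hS'.relMap_iff R fun i => Term.var (y i)).symm)

theorem IsTermModel.holds_iff (hU : IsUltra F) (hF : PreservesQuantifiers F)
    {S : L.Structure (Carrier F)} (hS : IsTermModel F S) (φ : Fml L) :
    Holds (hat F) φ ↔ cls T φ ∈ F := by
  induction hn : φ.size using Nat.strong_induction_on generalizing φ with
  | _ n ih =>
    cases φ with
    | eq t s => exact hS.realize_eq_realize hF t s
    | rel R ts => exact hS.relMap_iff R ts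
    | and φ ψ =>
      simp only [Fml.size] at hn
      rw [← cls_inf_cls, Order.PFilter.inf_mem_iff]
      exact and_congr (ih _ (by omega) φ rfl) (ih _ (by omega) ψ rfl)
    | not φ =>
      simp only [Fml.size] at hn
      rw [← compl_cls, hU.compl_mem_iff]
      exact not_congr (ih _ (by omega) φ rfl)
    | all k φ =>
      simp only [Fml.size] at hn
      -- Preservation of the supremum for `¬φ` becomes, by complementation, `[∀x_k.φ] ∈ F` iff all
      -- `[φ(k/p)] ∈ F`.
      have h := hF.ex_mem_iff φ.not k
      simp only [Fml.inst_not, ← compl_cls, cls_ex_not, hU.compl_mem_iff, ← not_forall] at h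
      rw [not_iff_not.1 h]
      have hp : ∀ p, Holds (Function.update (hat F) k (hat F p)) φ ↔ cls T (φ.inst k p) ∈ F :=
        fun p => holds_inst.symm.trans (ih _ (by omega) (φ.inst k p) (φ.size_inst k p))
      refine ⟨fun h p => (hp p).1 (h _), fun h a => ?_⟩
      rw [← hat_rep a]
      exact (hp _).2 (h _)

end TermModel

end FOL

/-! ### The completeness theorem -/

theorem mainTheorem7 (L : FirstOrder.Language.{u, v})
    [Countable (Σ n, L.Functions n)] [Countable (Σ n, L.Relations n)]
    (T : Set (FOL.Fml L)) (hT : ∀ φ ∈ T, φ.IsSentence) (hcons : FOL.Consistent T) :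
    FOL.HasModel T ∧
    (∀ (φ : FOL.Fml L) (k : ℕ), IsLUB (FOL.instances T φ k) (FOL.cls T (FOL.Fml.ex k φ))) ∧
    (∃ F : Order.PFilter (FOL.Lindenbaum T), FOL.IsUltra F ∧ FOL.PreservesQuantifiers F) ∧
    ∀ F : Order.PFilter (FOL.Lindenbaum T), FOL.IsUltra F → FOL.PreservesQuantifiers F →
      (∃! S : L.Structure (FOL.Carrier F), FOL.IsTermModel F S) ∧
      ∀ S : L.Structure (FOL.Carrier F), FOL.IsTermModel F S →
        (∀ φ : FOL.Fml L, FOL.Holds (FOL.hat F) φ ↔ FOL.cls T φ ∈ F) ∧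
        ∀ φ ∈ T, FOL.Holds (FOL.hat F) φ := by
  have hterm : ∀ F : Order.PFilter (FOL.Lindenbaum T), FOL.IsUltra F →
      FOL.PreservesQuantifiers F → ∀ S : L.Structure (FOL.Carrier F), FOL.IsTermModel F S →
        (∀ φ : FOL.Fml L, FOL.Holds (FOL.hat F) φ ↔ FOL.cls T φ ∈ F) ∧
        ∀ φ ∈ T, FOL.Holds (FOL.hat F) φ := fun F hU hF S hS =>
    ⟨hS.holds_iff hU hF, fun φ hφ =>
      (hS.holds_iff hU hF φ).2 (FOL.Provable.cls_mem (.hyp hφ))⟩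
  obtain ⟨F, hU, hF⟩ := FOL.exists_isUltra_preservesQuantifiers hcons
  have hS := FOL.isTermModel_termStructure hF
  -- The carrier is a quotient of `ℕ`, hence lies in `Type` whatever the universes of `L`.
  exact ⟨⟨FOL.Carrier F, FOL.termStructure hF, FOL.hat F, (hterm F hU hF _ hS).2⟩,
    FOL.isLUB_instances, ⟨F, hU, hF⟩, fun F hU hF =>
      ⟨⟨FOL.termStructure hF, FOL.isTermModel_termStructure hF,
        fun S hS => hS.unique hF (FOL.isTermModel_termStructure hF)⟩, hterm F hU hF⟩⟩
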